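/- **Theorem (Quantum Mass Production for quantum read-only memory).** For $f:\{0,1\}^n\to\{0,1\}^m$ let $O_f$ be the unitary operator on $n+m$ qubits with $O_f|x\rangle|\alpha\rangle=|x\rangle|\alpha\oplus f(x)\rangle$. A circuit $C$ on the work qubits and finitely many ancilla qubits *implements* a unitary $U$ on the work qubits if $C(|\psi\rangle\otimes|0\cdots0\rangle)=(U|\psi\rangle)\otimes|0\cdots0\rangle$ for every state $|\psi\rangle$ of the work qubits. There is a universal constant $K$ with the following property. Let $m\ge 1$ be a fixed integer. Let $\lambda=\lambda(n)$ be a function of $n$ whose values are powers of $2$ (including $2^0=1$), such that $$\lambda=o\!\left(\frac{2^{n/2}}{\sqrt n}\right)\qquad\text{and}\qquad 1\le\lambda\le 2^{n/2}m^{-1/2}\ \text{ for all sufficiently large } n .$$ Let $r=r(n)$ be a function of $n$ whose values are powers of $2$ (including $2^0=1$), such that $$\log_2 r=o\!\left(\frac{n-2\log_2\lambda}{\log_2 n}\right)\qquad (n\to\infty).$$ Then for every $n$ and every $f:\{0,1\}^n\to\{0,1\}^m$ there is a quantum circuit $C$ that implements $O_f^{\otimes r}$ and satisfies: 1. $C$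 is composed entirely of one- and two-qubit Clifford gates and Toffoli gates. 2. The number of one- and two-qubit Clifford gates in $C$ is at most $(K+o(1))\,2^n m$. 3. The number of Toffoli gates in $C$ is $(1+o(1))\,2^n\lambda^{-1}$. Here the $o(1)$ terms tend to $0$ as $n\to\infty$, for fixed $m$ and fixed functions $\lambda$ and $r$, uniformly in $f$. -/

import Mathlib

noncomputable section

namespace QROM

/-- Matrices of operators on the qubits indexed by `Q`, in the computational basis, whose elements
are the bit assignments `Q → Bool`. -/
abbrev Op (Q : Type) : Type := Matrix (Q → Bool) (Q → Bool) ℂ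

/-- The four single-qubit Pauli matrices, in the order `1, X, Y, Z`. -/
def pauliMatrix : Fin 4 → Matrix Bool Bool ℂ :=
  ![1,
    Matrix.of fun a b => if a = b then 0 else 1,
    Matrix.of fun a b => if a = b then 0 else if a then Complex.I else -Complex.I,
    Matrix.of fun a b => if a = b then (if a then -1 else 1) else 0]

/-- The tensor product over the qubits `q` of the Pauli matrices with labels `s q`. -/
def pauliString {Q : Type} [Fintype Q] (s : Q → Fin 4) : Op Q :=
  Matrix.of fun x y => ∏ q, pauliMatrix (s q) (x q) (y q)

/-- The Pauli group: all Pauli strings, with the phases `1, i, -1, -i`. -/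
def pauliGroup (Q : Type) [Fintype Q] : Set (Op Q) :=
  {P | ∃ (k : ℕ) (s : Q → Fin 4), P = Complex.I ^ k • pauliString s}

/-- Clifford operators: unitaries that conjugate the Pauli group into itself. -/
def IsClifford {Q : Type} [Fintype Q] [DecidableEq Q] (U : Op Q) : Prop :=
  U ∈ Matrix.unitaryGroup (Q → Bool) ℂ ∧
    ∀ P ∈ pauliGroup Q, U * P * U.conjTranspose ∈ pauliGroup Q

/-- The Toffoli gate `|a, b, c⟩ ↦ |a, b, c ⊕ ab⟩`. -/
def toffoliMatrix : Op (Fin 3) :=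
  Matrix.of fun x y =>
    if x 0 = y 0 ∧ x 1 = y 1 ∧ x 2 = xor (y 2) (y 0 && y 1) then 1 else 0

/-- The operator on the qubits `Q` that acts as `U` on the `k` distinct qubits
`e 0, …, e (k - 1)` and as the identity on all other qubits. -/
def embedOp {Q : Type} {k : ℕ} (e : Fin k ↪ Q) (U : Op (Fin k)) : Op Q :=
  open Classical in
  Matrix.of fun x y =>
    if ∀ q, q ∉ Set.range e → x q = y q then U (x ∘ e) (y ∘ e) else 0

/-- A gate on the qubits `Q`: a one- or two-qubit Clifford gate, or a Toffoli gate, together with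
the distinct qubits on which it acts. -/
inductive Gate (Q : Type) : Type
  | cliffordOne (U : Op (Fin 1)) (hU : IsClifford U) (e : Fin 1 ↪ Q) : Gate Q
  | cliffordTwo (U : Op (Fin 2)) (hU : IsClifford U) (e : Fin 2 ↪ Q) : Gate Q
  | toffoli (e : Fin 3 ↪ Q) : Gate Q

/-- The operator performed by a gate. -/
def Gate.op {Q : Type} : Gate Q → Op Q
  | .cliffordOne U _ e => embedOp e U
  | .cliffordTwo U _ e => embedOp e U
  | .toffoli e => embedOp e toffoliMatrix

/-- Whether a gate is a Toffoli gate (otherwise it is a one- or two-qubit Clifford gate). -/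
def Gate.isToffoli {Q : Type} : Gate Q → Bool
  | .cliffordOne _ _ _ => false
  | .cliffordTwo _ _ _ => false
  | .toffoli _ => true

/-- A circuit is a finite sequence of gates; the head of the list is applied first. -/
abbrev Circuit (Q : Type) : Type := List (Gate Q)

/-- The operator performed by a circuit. -/
def Circuit.op {Q : Type} [Fintype Q] [DecidableEq Q] : Circuit Q → Op Q
  | [] => 1
  | g :: C => Circuit.op C * g.op

/-- The number of Toffoli gates of a circuit. -/
def Circuit.toffoliCount {Q : Type} (C : Circuit Q) : ℕ :=
  C.countP fun g => g.isToffoli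

/-- The number of one- and two-qubit Clifford gates of a circuit. -/
def Circuit.cliffordCount {Q : Type} (C : Circuit Q) : ℕ :=
  C.countP fun g => !g.isToffoli

/-- The state `ψ ⊗ |0 ⋯ 0⟩` of the qubits `Q` together with `a` ancillas. -/
def withAncillas {Q : Type} (a : ℕ) (ψ : (Q → Bool) → ℂ) : (Q ⊕ Fin a → Bool) → ℂ :=
  fun x => if ∀ i, x (Sum.inr i) = false then ψ (x ∘ Sum.inl) else 0

/-- The circuit `C`, which acts on the qubits `Q` and `a` ancillas, implements `U`: on ancillas
initialised to `|0⟩` it performs `U` on the qubits `Q` and returns every ancilla to `|0⟩`. -/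
def Circuit.Implements {Q : Type} [Fintype Q] [DecidableEq Q] {a : ℕ}
    (C : Circuit (Q ⊕ Fin a)) (U : Op Q) : Prop :=
  ∀ ψ : (Q → Bool) → ℂ,
    Matrix.mulVec (Circuit.op C) (withAncillas a ψ) = withAncillas a (Matrix.mulVec U ψ)

/-- The oracle `O_f : |x⟩|α⟩ ↦ |x⟩|α ⊕ f(x)⟩`. The qubits `Sum.inl i` form the input register and
the qubits `Sum.inr j` the output register. -/
def oracle {n m : ℕ} (f : (Fin n → Bool) → (Fin m → Bool)) : Op (Fin n ⊕ Fin m) :=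
  Matrix.of fun y x =>
    if y ∘ Sum.inl = x ∘ Sum.inl ∧
        ∀ j, y (Sum.inr j) = xor (x (Sum.inr j)) (f (x ∘ Sum.inl) j)
    then 1 else 0

/-- The tensor power `U^{⊗ r}`, acting on `r` copies of the qubits `Q`. -/
def tensorPow {Q : Type} (r : ℕ) (U : Op Q) : Op (Fin r × Q) :=
  Matrix.of fun x y => ∏ i, U (fun q => x (i, q)) (fun q => y (i, q))

end QROM

end

/-!
The oracle `O_f` only permutes basis states, so it suffices to compute `r = 2 ^ t` values of `f`
by a classical circuit of XOR gates (a bounded number of Clifford gates each) and AND gates (one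
Toffoli gate each) on fresh wires. Copying the result out and uncomputing (`exists_reversible`)
doubles the counts once and for all.

A single value of a function of `n'` bits is found by table lookup (`massProduction_lookup`):
one-hot encode the first `n' - l` address bits, obtain by XORs alone the `2 ^ l` columns of the
table at this row, and select one of them with the last `l` bits. This takes about
`2 ^ (n' - l) + m 2 ^ l` AND gates and `O(2 ^ n' m)` XOR gates.

Values at two addresses are computed together by cutting `f` into `2 ^ k` functions `f_l` on `k`
fewer bits (`MassProduction.step`). Each `f_l` and the XOR of all of them is evaluated at only one
point, and both values can be recovered. So the number of values doubles while the cost grows only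
by the factor `1 + 2 ^ (-k)`, apart from routing. After `t` steps with `2 ^ k > n` this factor is
bounded (`two_pow_add_one_pow_le`). The selections cost `m λ 2 ^ (O(t log n))` and, for `t ≥ 1`,
the routing costs `m 2 ^ (O(t log n))`; both are negligible against `2 ^ n / λ` because
`t log n = o(n - 2 log λ)`.

The leading term of the number of Clifford gates does not depend on the number of columns of the
table. All constant factors in the number of Toffoli gates can therefore be absorbed by taking
`2 ^ l = 16 λ` columns instead of `λ` (`exists_circuit_of_le`), and Toffoli gates on ancillas in
the state `0` raise their number to exactly `2 ^ n / λ` for all large `n`.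
-/

namespace QROM

/-! ### Boolean circuits with AND and XOR costs -/

instance commutative_xor : Std.Commutative Bool.xor := ⟨Bool.xor_comm⟩

instance associative_xor : Std.Associative Bool.xor := ⟨Bool.xor_assoc⟩

/-- `Comp A B T C`: a Boolean straight-line computation that starts with wires carrying the
functions in `A` and ends with wires carrying, among others, all functions in `B`, using at most
`T` AND gates and XOR and constant gates of total weight at most `C`. An XOR gate has weight two
because writing `f ⊕ g` onto a fresh qubit takes two CNOT gates. Fan-out is free. -/
inductive Comp {X : Type} : Set (X → Bool) → Set (X → Bool) → ℕ → ℕ → Prop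
  | done {A B : Set (X → Bool)} {T C : ℕ} (h : B ⊆ A) : Comp A B T C
  | one {A B : Set (X → Bool)} {T C : ℕ} (h : Comp (insert (fun _ => true) A) B T C) :
      Comp A B T (C + 1)
  | xor {A B : Set (X → Bool)} {T C : ℕ} {f g : X → Bool} (hf : f ∈ A) (hg : g ∈ A)
      (h : Comp (insert (fun x => Bool.xor (f x) (g x)) A) B T C) : Comp A B T (C + 2)
  | and {A B : Set (X → Bool)} {T C : ℕ} {f g : X → Bool} (hf : f ∈ A) (hg : g ∈ A)
      (h : Comp (insert (fun x => f x && g x) A) B T C) : Comp A B (T + 1) C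

namespace Comp

variable {X : Type} {A B D : Set (X → Bool)} {T T' C C' : ℕ}

/-- A computation may be given larger budgets. -/
theorem mono_cost (h : Comp A B T C) : ∀ {T' C' : ℕ}, T ≤ T' → C ≤ C' → Comp A B T' C' := by
  induction h with
  | done h => intros; exact .done h
  | @one A B T C _ ih =>
    intro T' C' hT hC
    obtain ⟨c, rfl⟩ := Nat.exists_eq_add_of_le' (Nat.le_of_add_left_le hC)
    exact .one (ih hT (by omega))
  | @xor A B T C f g hf hg _ ih =>
    intro T' C' hT hC
    obtain ⟨c, rfl⟩ := Nat.exists_eq_add_of_le' (Nat.le_of_add_left_le hC)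
    exact .xor hf hg (ih hT (by omega))
  | @and A B T C f g hf hg _ ih =>
    intro T' C' hT hC
    obtain ⟨c, rfl⟩ := Nat.exists_eq_add_of_le' (Nat.le_of_add_left_le hT)
    exact .and hf hg (ih (by omega) hC)

theorem mono_source (h : Comp A B T C) : ∀ {A' : Set (X → Bool)}, A ⊆ A' → Comp A' B T C := by
  induction h with
  | done h => intro _ hA; exact .done (h.trans hA)
  | one _ ih => intro _ hA; exact .one (ih (Set.insert_subset_insert hA))
  | xor hf hg _ ih => intro _ hA; exact .xor (hA hf) (hA hg) (ih (Set.insert_subset_insert hA))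
  | and hf hg _ ih => intro _ hA; exact .and (hA hf) (hA hg) (ih (Set.insert_subset_insert hA))

theorem mono_target (h : Comp A B T C) : ∀ {B' : Set (X → Bool)}, B' ⊆ B → Comp A B' T C := by
  induction h with
  | done h => intro _ hB; exact .done (hB.trans h)
  | one _ ih => intro _ hB; exact .one (ih hB)
  | xor hf hg _ ih => intro _ hB; exact .xor hf hg (ih hB)
  | and hf hg _ ih => intro _ hB; exact .and hf hg (ih hB)

/-- Wires are never erased, so that a second computation can continue from the sources and the
targets of a first one. -/
theorem trans (h : Comp A B T C) :
    ∀ {D : Set (X → Bool)} {T' C' : ℕ}, Comp (A ∪ B) D T' C' →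
      Comp A (A ∪ B ∪ D) (T + T') (C + C') := by
  have keep : ∀ {A D : Set (X → Bool)} {T C : ℕ}, Comp A D T C → Comp A (A ∪ D) T C := by
    intro A D T C h
    induction h with
    | done h => exact .done (Set.union_subset le_rfl h)
    | one _ ih =>
      exact .one (ih.mono_target (Set.union_subset_union_left _ (Set.subset_insert _ _)))
    | xor hf hg _ ih =>
      exact .xor hf hg (ih.mono_target (Set.union_subset_union_left _ (Set.subset_insert _ _)))
    | and hf hg _ ih =>
      exact .and hf hg (ih.mono_target (Set.union_subset_union_left _ (Set.subset_insert _ _)))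
  induction h with
  | done h =>
    intro D T' C' h'
    rw [Set.union_eq_self_of_subset_right h] at h' ⊢
    exact (keep h').mono_cost (by omega) (by omega)
  | @one A B T C _ ih =>
    intro D T' C' h'
    have := ih (h'.mono_source (Set.union_subset_union_left _ (Set.subset_insert _ _)))
    refine mono_cost (.one (this.mono_target ?_)) le_rfl (by omega)
    exact Set.union_subset_union_left _ (Set.union_subset_union_left _ (Set.subset_insert _ _))
  | @xor A B T C f g hf hg _ ih =>
    intro D T' C' h'
    have := ih (h'.mono_source (Set.union_subset_union_left _ (Set.subset_insert _ _)))
    refine mono_cost (.xor hf hg (this.mono_target ?_)) le_rfl (by omega)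
    exact Set.union_subset_union_left _ (Set.union_subset_union_left _ (Set.subset_insert _ _))
  | @and A B T C f g hf hg _ ih =>
    intro D T' C' h'
    have := ih (h'.mono_source (Set.union_subset_union_left _ (Set.subset_insert _ _)))
    refine mono_cost (.and hf hg (this.mono_target ?_)) (by omega) le_rfl
    exact Set.union_subset_union_left _ (Set.union_subset_union_left _ (Set.subset_insert _ _))

theorem seq (h : Comp A B T C) (h' : Comp (A ∪ B) D T' C') : Comp A D (T + T') (C + C') :=
  (h.trans h').mono_target Set.subset_union_right

theorem union (h : Comp A B T C) (h' : Comp A D T' C') :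
    Comp A (B ∪ D) (T + T') (C + C') :=
  (h.trans (h'.mono_source Set.subset_union_left)).mono_target
    (Set.union_subset_union_left _ Set.subset_union_right)

theorem iUnion_of_forall {ι : Type} [Fintype ι] {B : ι → Set (X → Bool)}
    (h : ∀ i, Comp A (B i) T C) :
    Comp A (⋃ i, B i) (Fintype.card ι * T) (Fintype.card ι * C) := by
  classical
  have key : ∀ s : Finset ι, Comp A (⋃ i ∈ s, B i) (s.card * T) (s.card * C) := by
    intro s
    induction s using Finset.induction_on with
    | empty => exact .done (by simp)
    | insert i s hi ih =>
      rw [Finset.set_biUnion_insert, Finset.card_insert_of_notMem hi]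
      exact ((h i).union ih).mono_cost (by linarith) (by linarith)
  simpa using key Finset.univ

theorem xor_single {f g : X → Bool} (hf : f ∈ A) (hg : g ∈ A) :
    Comp A {fun x => Bool.xor (f x) (g x)} 0 2 :=
  .xor hf hg (.done (by simp))

/-! ### Multiplexers, one-hot encodings and parities -/

/-- If `c` then `f` else `g`, as `g ⊕ c(f ⊕ g)`. -/
theorem ite_single {c f g : X → Bool} (hc : c ∈ A) (hf : f ∈ A) (hg : g ∈ A) :
    Comp A {fun x => if c x then f x else g x} 1 4 := by
  refine .xor hf hg (.and (f := c) (Set.mem_insert_of_mem _ hc) (Set.mem_insert _ _)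
    (.xor (f := g) (C := 0) (by simp [hg]) (Set.mem_insert _ _) (.done ?_)))
  rw [Set.singleton_subset_iff]
  convert Set.mem_insert _ _ using 1
  funext x
  cases c x <;> cases f x <;> cases g x <;> rfl

/-- A multiplexer selects the function with address `y x` among the functions `D b`. -/
theorem mux : ∀ {k : ℕ} {D : (Fin k → Bool) → X → Bool} {y : Fin k → X → Bool},
    (∀ b, D b ∈ A) → (∀ q, y q ∈ A) →
      Comp A {fun x => D (fun q => y q x) x} (2 ^ k - 1) (4 * (2 ^ k - 1))
  | 0, D, y, hD, _ => .done (by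
      rw [Set.singleton_subset_iff]
      convert hD Fin.elim0 using 3)
  | k + 1, D, y, hD, hy => by
      have h (b : Bool) := mux (k := k) (D := fun l => D (Fin.cons b l))
        (y := fun q => y q.succ) (fun l => hD _) (fun q => hy _)
      have cons (x : X) : (fun q => y q x) = Fin.cons (y 0 x) fun q => y q.succ x := by
        funext q; exact Fin.cases rfl (fun _ => rfl) q
      have last := ite_single (c := y 0)
        (f := fun x => D (Fin.cons true fun q => y q.succ x) x)
        (g := fun x => D (Fin.cons false fun q => y q.succ x) x)
        (A := A ∪ ({fun x => D (Fin.cons true fun q => y q.succ x) x} ∪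
          {fun x => D (Fin.cons false fun q => y q.succ x) x}))
        (Or.inl (hy 0)) (Or.inr (Or.inl rfl)) (Or.inr (Or.inr rfl))
      have pos := Nat.one_le_two_pow (n := k)
      refine ((((h true).union (h false)).seq last).mono_target ?_).mono_cost ?_ ?_
      · rw [Set.singleton_subset_iff, Set.mem_singleton_iff]
        funext x
        rw [cons]
        cases y 0 x <;> rfl
      · rw [pow_succ]; omega
      · rw [pow_succ]; omega

/-- All indicator functions of the values of `d` Boolean functions, computed level by level along
the binary tree of prefixes. -/
theorem oneHot : ∀ {d : ℕ} {y : Fin d → X → Bool}, (∀ q, y q ∈ A) →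
    Comp A (Set.range fun (a : Fin d → Bool) x => decide ((fun q => y q x) = a))
      (2 ^ d) (2 * 2 ^ d)
  | 0, y, _ => by
      refine mono_cost (.one (C := 0) (T := 0) (.done ?_)) (by simp) (by simp)
      rintro _ ⟨a, rfl⟩
      left
      funext x
      simp [Subsingleton.elim _ a]
  | d + 1, y, hy => by
      have ih := oneHot (d := d) (y := fun q => y q.succ) fun q => hy _
      have cons (x : X) : (fun q => y q x) = Fin.cons (y 0 x) fun q => y q.succ x := by
        funext q; exact Fin.cases rfl (fun _ => rfl) q
      have step (a : Fin d → Bool) :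
          Comp (A ∪ Set.range fun (a : Fin d → Bool) x => decide ((fun q => y q.succ x) = a))
            {g | ∃ b : Bool, g = fun x => decide ((fun q => y q x) = Fin.cons b a)} 1 2 := by
        refine .and (f := y 0) (g := fun x => decide ((fun q => y q.succ x) = a))
          (Or.inl (hy 0)) (Or.inr ⟨a, rfl⟩) (.xor (C := 0)
            (f := fun x => decide ((fun q => y q.succ x) = a)) (Or.inr (Or.inr ⟨a, rfl⟩))
            (Set.mem_insert _ _) (.done ?_))
        rintro _ ⟨b, rfl⟩
        cases b
        · left
          funext x
          rw [cons]
          cases y 0 x <;> simp [Fin.cons_inj]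
        · right; left
          funext x
          rw [cons]
          cases y 0 x <;> simp [Fin.cons_inj]
      refine ((ih.seq (iUnion_of_forall step)).mono_target ?_).mono_cost ?_ ?_
      · rintro _ ⟨a, rfl⟩
        exact Set.mem_iUnion.2 ⟨Fin.tail a, a 0, by simp [Fin.cons_self_tail]⟩
      · simp [pow_succ]; omega
      · simp [pow_succ]; omega

/-- The XOR of any number of available functions. The constant `3` pays for the empty XOR, which
is obtained as `1 ⊕ 1`. -/
theorem fold_xor {ι : Type} {g : ι → X → Bool} (s : Finset ι) (hg : ∀ i, g i ∈ A) :
    Comp A {fun x => s.fold Bool.xor false fun i => g i x} 0 (2 * s.card + 3) := by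
  classical
  induction s using Finset.induction_on with
  | empty =>
    exact .one (.xor (C := 0) (Set.mem_insert _ _) (Set.mem_insert _ _) (.done (by simp)))
  | insert i s hi ih =>
    rw [Finset.card_insert_of_notMem hi]
    simp only [Finset.fold_insert hi]
    exact (ih.seq (xor_single (Or.inl (hg i)) (Or.inr rfl))).mono_cost le_rfl (by omega)

/-- An arbitrary function of `d` bits whose one-hot encoding is available needs no AND gate. -/
theorem of_oneHot {d : ℕ} {y : Fin d → X → Bool} (F : (Fin d → Bool) → Bool)
    (h : ∀ a : Fin d → Bool, (fun x => decide ((fun q => y q x) = a)) ∈ A) :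
    Comp A {fun x => F fun q => y q x} 0 (2 * 2 ^ d + 3) := by
  classical
  have key (s : Finset (Fin d → Bool)) (z : Fin d → Bool) :
      (s.fold Bool.xor false fun a => decide (z = a)) = decide (z ∈ s) := by
    induction s using Finset.induction_on with
    | empty => simp
    | insert a s ha ih =>
      rw [Finset.fold_insert ha, ih]
      by_cases hz : z = a
      · subst hz; simp [ha]
      · simp [hz]
  have := fold_xor (Finset.univ.filter fun a => F a = true) h
  simp only [key] at this
  simp only [Finset.mem_filter, Finset.mem_univ, true_and, Bool.decide_eq_true] at this
  refine this.mono_cost le_rfl ?_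
  have := Finset.card_le_univ (Finset.univ.filter fun a => F a = true)
  simp at this
  omega

end Comp

/-! ### Mass production of Boolean functions -/

/-- Any function with `n` input bits and `m` output bits can be evaluated on any `2 ^ t` inputs
with at most `T` AND gates and XOR weight at most `C`. -/
def MassProduction (m n t T C : ℕ) : Prop :=
  ∀ (f : (Fin n → Bool) → Fin m → Bool) {ι : Type} [Fintype ι], Fintype.card ι = 2 ^ t →
    ∀ {X : Type} {A : Set (X → Bool)} (u : ι → Fin n → X → Bool), (∀ p q, u p q ∈ A) →
      Comp A {g | ∃ p j, g = fun x => f (fun q => u p q x) j} T C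

/-- A single evaluation by table lookup. The first `d` address bits are one-hot encoded; XORs of
the encoding give, for each value of the last `l` address bits, the value of `f`; the last `l`
address bits select among these. -/
theorem massProduction_lookup {m : ℕ} (hm : 1 ≤ m) (d l : ℕ) :
    MassProduction m (d + l) 0 (2 ^ d + m * 2 ^ l) (13 * (2 ^ (d + l) * m)) := by
  intro f ι _ hι X A u hu
  let y (p : ι) (x : X) : Fin d → Bool := fun q => u p (Fin.castAdd l q) x
  let z (p : ι) (x : X) : Fin l → Bool := fun q => u p (Fin.natAdd d q) x
  have split (p : ι) (x : X) : (fun q => u p q x) = Fin.append (y p x) (z p x) :=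
    (Fin.append_castAdd_natAdd (f := fun q => u p q x)).symm
  have encode (p : ι) := Comp.oneHot (A := A) (y := fun q => u p (Fin.castAdd l q))
    fun q => hu p _
  have column (p : ι) (b : Fin l → Bool) (j : Fin m) :
      Comp (A ∪ Set.range fun (a : Fin d → Bool) x => decide (y p x = a))
        {fun x => f (Fin.append (y p x) b) j} 0 (2 * 2 ^ d + 3) :=
    Comp.of_oneHot (y := fun q => u p (Fin.castAdd l q)) (fun a => f (Fin.append a b) j)
      fun a => Or.inr ⟨a, rfl⟩
  have columns (p : ι) (j : Fin m) := Comp.iUnion_of_forall fun b => column p b j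
  have select (p : ι) (j : Fin m) := Comp.mux
    (A := A ∪ Set.range (fun (a : Fin d → Bool) x => decide (y p x = a)) ∪
      ⋃ b, {fun x => f (Fin.append (y p x) b) j})
    (D := fun b x => f (Fin.append (y p x) b) j) (y := fun q => u p (Fin.natAdd d q))
    (fun b => Or.inr (Set.mem_iUnion.2 ⟨b, rfl⟩)) (fun q => Or.inl (Or.inl (hu p _)))
  have all := Comp.iUnion_of_forall fun p => (encode p).seq
    (Comp.iUnion_of_forall fun j => (columns p j).seq (select p j))
  refine (all.mono_target ?_).mono_cost ?_ ?_
  · rintro _ ⟨p, j, rfl⟩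
    refine Set.mem_iUnion.2 ⟨p, Set.mem_iUnion.2 ⟨j, ?_⟩⟩
    rw [Set.mem_singleton_iff]
    funext x
    rw [split]
  · simp only [hι, Fintype.card_fin, Fintype.card_pi, Fintype.card_bool, Finset.prod_const,
      Finset.card_univ, mul_zero, zero_add, pow_zero, one_mul]
    exact Nat.add_le_add_left (Nat.mul_le_mul_left _ (Nat.sub_le _ _)) _
  · simp only [hι, Fintype.card_fin, Fintype.card_pi, Fintype.card_bool, Finset.prod_const,
      Finset.card_univ, pow_zero, one_mul]
    have hd := Nat.one_le_two_pow (n := d)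
    have hl := Nat.one_le_two_pow (n := l)
    have h1 : 2 ^ l * (2 * 2 ^ d + 3) + 4 * (2 ^ l - 1) ≤ 2 ^ l * (9 * 2 ^ d) := by
      have : 2 ^ l * (2 * 2 ^ d + 3) + 4 * (2 ^ l - 1) ≤ 2 ^ l * (2 * 2 ^ d + 7) := by
        rw [Nat.mul_add, Nat.mul_add]; omega
      exact this.trans (Nat.mul_le_mul_left _ (by omega))
    have h2 : 2 ^ d ≤ 2 ^ d * 2 ^ l * m := by
      rw [Nat.mul_assoc]; exact Nat.le_mul_of_pos_right _ (Nat.mul_pos hl hm)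
    have h3 := Nat.mul_le_mul_left m h1
    rw [pow_add]
    nlinarith

/-- Replacing one summand of an XOR. -/
theorem fold_xor_update {ι : Type} [Fintype ι] [DecidableEq ι] (g : ι → Bool) (i : ι) (c : Bool) :
    (Finset.univ.fold Bool.xor false fun l => if l = i then c else g l) =
      Bool.xor (Bool.xor (Finset.univ.fold Bool.xor false g) (g i)) c := by
  rw [← Finset.insert_erase (Finset.mem_univ i), Finset.fold_insert (Finset.notMem_erase _ _),
    Finset.fold_insert (Finset.notMem_erase _ _),
    Finset.fold_congr (g := g) fun l hl => if_neg (Finset.ne_of_mem_erase hl)]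
  simp only [if_true]
  generalize Finset.fold Bool.xor false g _ = s
  cases s <;> cases g i <;> cases c <;> rfl

/-- The mass production step. Let `f_l` be the function `f` with its first `k` input bits fixed to
`l`, and `f_⊕` the XOR of all `f_l`. For inputs `(i, z)` and `(j, w)`, each `f_l` is evaluated only
once, at `z` if `l = i` and at `w` otherwise, and `f_⊕` is evaluated at `w`. The value of `f_i` is
`f_i(z)`; the value of `f_j` is `f_j(w)` if `i ≠ j`; and the XOR of all values is
`f_i(z) ⊕ f_i(w)`, which corrects the value of `f_j` to `f_j(w)` if `i = j`. Since the functions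
`f_l` and `f_⊕` are again mass-produced, `2 ^ k + 1` of them serve `2 ^ (t + 1)` inputs. -/
theorem MassProduction.step {m n t T C : ℕ} (h : MassProduction m n t T C) (k : ℕ) :
    MassProduction m (k + n) (t + 1)
      ((2 ^ k + 1) * T + 2 ^ t * (21 * 2 ^ k * (n + m + 1)))
      ((2 ^ k + 1) * C + 2 ^ t * (21 * 2 ^ k * (n + m + 1))) := by
  intro f ι' _ hι' X A u' hu'
  let κ := Fin (2 ^ t)
  have hκ : Fintype.card κ = 2 ^ t := Fintype.card_fin _
  have e : κ × Bool ≃ ι' := Fintype.equivOfCardEq (by simp [hι', hκ, pow_succ])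
  let u (p : κ) (b : Bool) (q : Fin (k + n)) : X → Bool := u' (e (p, b)) q
  have hu (p : κ) (b : Bool) (q : Fin (k + n)) : u p b q ∈ A := hu' _ _
  let hi (p : κ) (b : Bool) (x : X) : Fin k → Bool := fun q => u p b (Fin.castAdd n q) x
  let lo (p : κ) (b : Bool) (x : X) : Fin n → Bool := fun q => u p b (Fin.natAdd k q) x
  have split (p : κ) (b : Bool) (x : X) :
      (fun q => u p b q x) = Fin.append (hi p b x) (lo p b x) :=
    (Fin.append_castAdd_natAdd (f := fun q => u p b q x)).symm
  let route (p : κ) (l : Fin k → Bool) (q : Fin n) : X → Bool := fun x =>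
    if decide (hi p false x = l) then lo p false x q else lo p true x q
  let F (l : Fin k → Bool) (y : Fin n → Bool) (j : Fin m) : Bool := f (Fin.append l y) j
  let S (y : Fin n → Bool) (j : Fin m) : Bool := Finset.univ.fold Bool.xor false fun l => F l y j
  let A₁ := A ∪ ⋃ p, Set.range fun (l : Fin k → Bool) x => decide (hi p false x = l)
  let A₂ := A₁ ∪ ⋃ i : κ × (Fin k → Bool) × Fin n, {route i.1 i.2.1 i.2.2}
  let A₃ := A₂ ∪ ⋃ l, {g | ∃ p j, g = fun x => F l (fun q => route p l q x) j}
  let A₄ := A₃ ∪ {g | ∃ p j, g = fun x => S (fun q => u p true (Fin.natAdd k q) x) j}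
  have encode := Comp.iUnion_of_forall fun p : κ =>
    Comp.oneHot (A := A) (y := fun q => u p false (Fin.castAdd n q)) fun q => hu _ _ _
  have routes : Comp A₁ (⋃ i : κ × (Fin k → Bool) × Fin n, {route i.1 i.2.1 i.2.2}) _ _ :=
    Comp.iUnion_of_forall fun i =>
      Comp.ite_single (A := A₁) (c := fun x => decide (hi i.1 false x = i.2.1))
        (f := u i.1 false (Fin.natAdd k i.2.2)) (g := u i.1 true (Fin.natAdd k i.2.2))
        (Or.inr (Set.mem_iUnion.2 ⟨i.1, i.2.1, rfl⟩)) (Or.inl (hu _ _ _)) (Or.inl (hu _ _ _))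
  have values : Comp A₂ (⋃ l, {g | ∃ p j, g = fun x => F l (fun q => route p l q x) j}) _ _ :=
    Comp.iUnion_of_forall fun l => h (F l) hκ (A := A₂) (fun p => route p l)
      fun p q => Or.inr (Set.mem_iUnion.2 ⟨(p, l, q), rfl⟩)
  have parity : Comp A₃ {g | ∃ p j, g = fun x => S (fun q => u p true (Fin.natAdd k q) x) j} _ _ :=
    h S hκ (A := A₃) (fun p q => u p true (Fin.natAdd k q))
      fun p q => Or.inl (Or.inl (Or.inl (hu _ _ _)))
  let V (p : κ) (j : Fin m) (l : Fin k → Bool) : X → Bool := fun x => F l (fun q => route p l q x) j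
  have hV (p : κ) (j : Fin m) (l : Fin k → Bool) : V p j l ∈ A₄ :=
    Or.inl (Or.inr (Set.mem_iUnion.2 ⟨l, p, j, rfl⟩))
  have hA : A ⊆ A₄ := fun _ ha => Or.inl (Or.inl (Or.inl (Or.inl ha)))
  have out₀ (p : κ) (j : Fin m) := Comp.mux (A := A₄) (D := V p j)
    (y := fun q => u p false (Fin.castAdd n q)) (hV p j) fun q => hA (hu _ _ _)
  have pick (p : κ) (j : Fin m) := Comp.mux (A := A₄) (D := V p j)
    (y := fun q => u p true (Fin.castAdd n q)) (hV p j) fun q => hA (hu _ _ _)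
  have collide (p : κ) := Comp.mux (A := A₄) (D := fun l x => decide (hi p false x = l))
    (y := fun q => u p true (Fin.castAdd n q))
    (fun l => Or.inl (Or.inl (Or.inl (Or.inr (Set.mem_iUnion.2 ⟨p, l, rfl⟩)))))
    fun q => hA (hu _ _ _)
  have sum (p : κ) (j : Fin m) := Comp.fold_xor (A := A₄) Finset.univ (hV p j)
  have out₁ (p : κ) (j : Fin m) :
      Comp A₄ {fun x => Bool.xor (V p j (hi p true x) x)
        ((decide (hi p false x = hi p true x)) &&
          Bool.xor (Finset.univ.fold Bool.xor false fun l => V p j l x)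
            (S (fun q => u p true (Fin.natAdd k q) x) j))} _ _ :=
    (((pick p j).union (collide p)).union (sum p j)).seq
      (.xor (f := fun x => Finset.univ.fold Bool.xor false fun l => V p j l x)
        (g := fun x => S (fun q => u p true (Fin.natAdd k q) x) j)
        (Or.inr (Or.inr rfl)) (Or.inl (Or.inr ⟨p, j, rfl⟩))
        (.and (f := fun x => decide (hi p false x = hi p true x))
          (Or.inr (Or.inr (Or.inl (Or.inr rfl)))) (Set.mem_insert _ _)
          (.xor (T := 0) (C := 0) (f := fun x => V p j (hi p true x) x)
            (Or.inr (Or.inr (Or.inr (Or.inl (Or.inl rfl))))) (Set.mem_insert _ _)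
            (.done (Set.singleton_subset_iff.2 (Set.mem_insert _ _))))))
  have outs := Comp.iUnion_of_forall fun i : κ × Fin m =>
    (out₀ i.1 i.2).union (out₁ i.1 i.2)
  have all := encode.seq (routes.seq (values.seq (parity.seq outs)))
  refine (all.mono_target ?_).mono_cost ?_ ?_
  · rintro _ ⟨p', j, rfl⟩
    obtain ⟨⟨p, b⟩, rfl⟩ := e.surjective p'
    refine Set.mem_iUnion.2 ⟨(p, j), ?_⟩
    have hroute (x : X) (l : Fin k → Bool) : (fun q => route p l q x) =
        if hi p false x = l then lo p false x else lo p true x := by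
      funext q
      by_cases hl : hi p false x = l <;> simp [route, hl]
    cases b
    · left
      rw [Set.mem_singleton_iff]
      funext x
      change f (fun q => u p false q x) j = F _ (fun q => route p (hi p false x) q x) j
      rw [hroute, if_pos rfl, split]
    · right
      rw [Set.mem_singleton_iff]
      funext x
      change f (fun q => u p true q x) j = Bool.xor (F _ (fun q => route p (hi p true x) q x) j)
        (decide (hi p false x = hi p true x) &&
          Bool.xor (Finset.univ.fold Bool.xor false fun l => F l (fun q => route p l q x) j)
          (S (lo p true x) j))
      have hsum : (Finset.univ.fold Bool.xor false fun l => F l (fun q => route p l q x) j) =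
          Finset.univ.fold Bool.xor false fun l =>
            if l = hi p false x then F (hi p false x) (lo p false x) j
            else F l (lo p true x) j := by
        congr 1
        funext l
        rw [hroute]
        by_cases hl : hi p false x = l
        · subst hl; simp
        · simp [hl, Ne.symm hl]
      rw [hsum, fold_xor_update, hroute, split]
      by_cases hij : hi p false x = hi p true x
      · rw [← hij]
        simp only [if_true, decide_true, Bool.true_and, S, F]
        generalize Finset.fold Bool.xor false _ _ = s
        generalize f _ j = a
        generalize f _ j = b
        cases s <;> cases a <;> cases b <;> rfl
      · simp [hij, F]
  · simp only [hκ, Fintype.card_fin, Fintype.card_pi, Fintype.card_bool, Finset.prod_const,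
      Finset.card_univ, Fintype.card_prod]
    have hk := Nat.one_le_two_pow (n := k)
    have h1 : 2 ^ k - 1 + (2 ^ k - 1 + (2 ^ k - 1) + 0 + (0 + 1)) ≤ 3 * 2 ^ k := by omega
    have h2 := Nat.mul_le_mul_left (2 ^ t * m) h1
    have h3 : 0 ≤ 2 ^ t * 2 ^ k * n := by positivity
    have h4 : 0 ≤ 2 ^ t * 2 ^ k * m := by positivity
    have h5 : 0 ≤ 2 ^ t * 2 ^ k := by positivity
    nlinarith
  · simp only [hκ, Fintype.card_fin, Fintype.card_pi, Fintype.card_bool, Finset.prod_const,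
      Finset.card_univ, Fintype.card_prod]
    have hk := Nat.one_le_two_pow (n := k)
    have h1 : 4 * (2 ^ k - 1) + (4 * (2 ^ k - 1) + 4 * (2 ^ k - 1) + (2 * 2 ^ k + 3) +
      (0 + 2 + 2)) ≤ 21 * 2 ^ k := by omega
    have h2 := Nat.mul_le_mul_left (2 ^ t * m) h1
    have h3 : 0 ≤ 2 ^ t * 2 ^ k * n := by positivity
    have h4 : 0 ≤ 2 ^ t * 2 ^ k * m := by positivity
    have h5 : 0 ≤ 2 ^ t * 2 ^ k := by positivity
    nlinarith

theorem MassProduction.iterate {m n T C k N : ℕ} (h : MassProduction m n 0 T C) :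
    ∀ t, t * k + n ≤ N → MassProduction m (t * k + n) t
      ((2 ^ k + 1) ^ t * (T + t * (21 * 2 ^ k * (N + m + 1))))
      ((2 ^ k + 1) ^ t * (C + t * (21 * 2 ^ k * (N + m + 1))))
  | 0, _ => by simpa using h
  | t + 1, hN => by
      have hn : (t + 1) * k + n = k + (t * k + n) := by ring
      rw [hn] at hN ⊢
      have key (T : ℕ) : (2 ^ k + 1) * ((2 ^ k + 1) ^ t * (T + t * (21 * 2 ^ k * (N + m + 1)))) +
          2 ^ t * (21 * 2 ^ k * (t * k + n + m + 1)) ≤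
          (2 ^ k + 1) ^ (t + 1) * (T + (t + 1) * (21 * 2 ^ k * (N + m + 1))) := by
        have h1 : 2 ^ t ≤ (2 ^ k + 1) ^ (t + 1) :=
          (Nat.pow_le_pow_left (Nat.succ_le_succ Nat.one_le_two_pow) t).trans
            (Nat.pow_le_pow_right (Nat.succ_pos _) (Nat.le_succ t))
        have h2 : 21 * 2 ^ k * (t * k + n + m + 1) ≤ 21 * 2 ^ k * (N + m + 1) :=
          Nat.mul_le_mul_left _ (by omega)
        have h3 := Nat.mul_le_mul h1 h2
        rw [pow_succ] at h3 ⊢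
        linarith
      intro f ι _ hι X A u hu
      exact ((h.iterate t (by omega)).step k f hι u hu).mono_cost (key T) (key C)

/-! ### Reversible programs -/

/-- A classical reversible gate on the wires `W`: NOT, CNOT or Toffoli, the target `t` last. -/
inductive RGate (W : Type) : Type
  | not (t : W) : RGate W
  | cnot (c t : W) (h : c ≠ t) : RGate W
  | toffoli (a b t : W) (hab : a ≠ b) (hat : a ≠ t) (hbt : b ≠ t) : RGate W

namespace RGate

variable {W V : Type}

/-- The wire on which a gate acts. -/
def target : RGate W → W
  | not t => t
  | cnot _ t _ => t
  | toffoli _ _ t _ _ _ => t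

/-- Whether a gate flips its target. -/
def flips : RGate W → (W → Bool) → Bool
  | not _, _ => true
  | cnot c _ _, s => s c
  | toffoli a b _ _ _ _, s => s a && s b

open Classical in
/-- The action of a gate on bit assignments. -/
noncomputable def act (g : RGate W) (s : W → Bool) : W → Bool :=
  Function.update s g.target (Bool.xor (s g.target) (g.flips s))

/-- Whether a gate is a Toffoli gate. -/
def isToffoli : RGate W → Bool
  | not _ => false
  | cnot _ _ _ => false
  | toffoli _ _ _ _ _ _ => true

/-- The same gate on renamed wires. -/
def map (φ : W ↪ V) : RGate W → RGate V
  | not t => not (φ t)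
  | cnot c t h => cnot (φ c) (φ t) (φ.injective.ne h)
  | toffoli a b t hab hat hbt =>
    toffoli (φ a) (φ b) (φ t) (φ.injective.ne hab) (φ.injective.ne hat) (φ.injective.ne hbt)

@[simp] theorem isToffoli_map (φ : W ↪ V) (g : RGate W) : (g.map φ).isToffoli = g.isToffoli := by
  cases g <;> rfl

theorem act_act (g : RGate W) (s : W → Bool) : g.act (g.act s) = s := by
  have h : g.flips (g.act s) = g.flips s := by
    cases g with
    | not t => rfl
    | cnot c t h => simp [flips, act, target, h]
    | toffoli a b t hab hat hbt => simp [flips, act, target, hat, hbt]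
  rw [act, h]
  funext w
  by_cases hw : w = g.target
  · subst hw; simp [act]
  · simp [act, hw]

theorem act_map_apply (φ : W ↪ V) (g : RGate W) (s : V → Bool) (w : W) :
    (g.map φ).act s (φ w) = g.act (s ∘ φ) w := by
  have ht : (g.map φ).target = φ g.target := by cases g <;> rfl
  have hf : (g.map φ).flips s = g.flips (s ∘ φ) := by cases g <;> rfl
  rw [act, act, ht, hf]
  by_cases hw : w = g.target
  · subst hw; simp
  · simp [hw]

theorem act_map_of_notMem (φ : W ↪ V) (g : RGate W) (s : V → Bool) {v : V}
    (hv : v ∉ Set.range φ) : (g.map φ).act s v = s v := by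
  have (w : W) : v ≠ φ w := fun h => hv ⟨w, h.symm⟩
  cases g <;> simp [act, map, target, this]

end RGate

/-- The action of a list of gates, the head first. -/
noncomputable def run {W : Type} : List (RGate W) → (W → Bool) → W → Bool
  | [], s => s
  | g :: P, s => run P (g.act s)

section run

variable {W V : Type}

theorem run_append (P P' : List (RGate W)) (s : W → Bool) :
    run (P ++ P') s = run P' (run P s) := by
  induction P generalizing s with
  | nil => rfl
  | cons g P ih => exact ih _

theorem run_reverse_run (P : List (RGate W)) (s : W → Bool) : run P.reverse (run P s) = s := by
  induction P generalizing s with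
  | nil => rfl
  | cons g P ih =>
    rw [List.reverse_cons, run_append]
    exact (congrArg g.act (ih _)).trans (g.act_act s)

theorem run_map_comp (φ : W ↪ V) (P : List (RGate W)) (s : V → Bool) :
    run (P.map (RGate.map φ)) s ∘ φ = run P (s ∘ φ) := by
  induction P generalizing s with
  | nil => rfl
  | cons g P ih =>
    rw [List.map_cons, run, run, ih]
    congr 1
    funext w
    exact g.act_map_apply φ s w

theorem run_map_of_notMem (φ : W ↪ V) (P : List (RGate W)) (s : V → Bool) {v : V}
    (hv : v ∉ Set.range φ) : run (P.map (RGate.map φ)) s v = s v := by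
  induction P generalizing s with
  | nil => rfl
  | cons g P ih =>
    rw [List.map_cons, run, ih]
    exact g.act_map_of_notMem φ s hv

end run

/-! ### Compilation of Boolean circuits -/

/-- A wire type `W` is extended by one fresh wire, initially `0`, which a program `P₀` turns into
`f x`; then a program for the extended wires continues. -/
theorem exists_program_of_extend {X W : Type} {B : Set (X → Bool)} {init : X → W → Bool}
    {f : X → Bool} {T C T₀ C₀ : ℕ} (P₀ : List (RGate (W ⊕ Unit)))
    (hT₀ : P₀.countP RGate.isToffoli ≤ T₀) (hC₀ : (P₀.countP fun g => !g.isToffoli) ≤ C₀)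
    (h₀ : ∀ x, run P₀ (Sum.elim (init x) fun _ => false) = Sum.elim (init x) fun _ => f x)
    (h : ∃ (V : Type) (_ : Fintype V) (P : List (RGate ((W ⊕ Unit) ⊕ V))),
      P.countP RGate.isToffoli ≤ T ∧ (P.countP fun g => !g.isToffoli) ≤ C ∧
      ∀ g ∈ B, ∃ w, ∀ x, run P (Sum.elim (Sum.elim (init x) fun _ => f x) fun _ => false) w = g x) :
    ∃ (V : Type) (_ : Fintype V) (P : List (RGate (W ⊕ V))),
      P.countP RGate.isToffoli ≤ T₀ + T ∧ (P.countP fun g => !g.isToffoli) ≤ C₀ + C ∧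
      ∀ g ∈ B, ∃ w, ∀ x, run P (Sum.elim (init x) fun _ => false) w = g x := by
  obtain ⟨V, _, P, hT, hC, hP⟩ := h
  let α := (Equiv.sumAssoc W Unit V).toEmbedding
  let β : W ⊕ Unit ↪ W ⊕ (Unit ⊕ V) := Function.Embedding.inl.trans α
  have count (p : Bool → Bool) (P : List (RGate (W ⊕ Unit))) :
      (P.map (RGate.map β)).countP (fun g => p g.isToffoli) = P.countP fun g => p g.isToffoli := by
    rw [List.countP_map]; congr 1; funext g; simp
  have count' (p : Bool → Bool) (P : List (RGate ((W ⊕ Unit) ⊕ V))) :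
      (P.map (RGate.map α)).countP (fun g => p g.isToffoli) = P.countP fun g => p g.isToffoli := by
    rw [List.countP_map]; congr 1; funext g; simp
  refine ⟨Unit ⊕ V, inferInstance, P₀.map (RGate.map β) ++ P.map (RGate.map α), ?_, ?_, ?_⟩
  · rw [List.countP_append]
    exact Nat.add_le_add ((count id P₀).trans_le hT₀) ((count' id P).trans_le hT)
  · rw [List.countP_append]
    exact Nat.add_le_add ((count not P₀).trans_le hC₀) ((count' not P).trans_le hC)
  · intro g hg
    obtain ⟨w, hw⟩ := hP g hg
    refine ⟨α w, fun x => ?_⟩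
    rw [run_append, ← hw x]
    refine (congrFun (run_map_comp α P _) w).trans ?_
    congr 1
    funext v
    rcases v with v | v
    · refine (congrFun (run_map_comp β P₀ _) v).trans ?_
      refine Eq.trans ?_ (congrFun (h₀ x) v)
      congr 1
      funext v
      rcases v with v | v <;> rfl
    · refine (run_map_of_notMem β P₀ _ ?_).trans rfl
      rintro ⟨v', hv⟩
      exact Sum.inl_ne_inr (α.injective (hv : α (Sum.inl v') = α (Sum.inr v)))

/-- A Boolean circuit is a reversible program on fresh wires, without erasure. -/
theorem Comp.exists_program {X : Type} {A B : Set (X → Bool)} {T C : ℕ} (h : Comp A B T C) :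
    ∀ {W : Type} (init : X → W → Bool), (∀ f ∈ A, ∃ w, ∀ x, init x w = f x) →
      ∃ (V : Type) (_ : Fintype V) (P : List (RGate (W ⊕ V))),
        P.countP RGate.isToffoli ≤ T ∧ (P.countP fun g => !g.isToffoli) ≤ C ∧
        ∀ f ∈ B, ∃ w, ∀ x, run P (Sum.elim (init x) fun _ => false) w = f x := by
  have extend {A : Set (X → Bool)} {W : Type} {init : X → W → Bool} {f : X → Bool}
      (hA : ∀ f ∈ A, ∃ w, ∀ x, init x w = f x) :
      ∀ g ∈ insert f A, ∃ w, ∀ x,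
        (Sum.elim (init x) fun _ => f x : W ⊕ Unit → Bool) w = g x := by
    rintro g (rfl | hg)
    · exact ⟨Sum.inr (), fun _ => rfl⟩
    · obtain ⟨w, hw⟩ := hA g hg
      exact ⟨Sum.inl w, hw⟩
  induction h with
  | done h =>
    intro W init hA
    refine ⟨Empty, inferInstance, [], by simp, by simp, fun f hf => ?_⟩
    obtain ⟨w, hw⟩ := hA f (h hf)
    exact ⟨Sum.inl w, hw⟩
  | @one A B T C _ ih =>
    intro W init hA
    have := exists_program_of_extend (T₀ := 0) (C₀ := 1) [RGate.not (Sum.inr ())] le_rfl le_rfl ?_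
      (ih _ (extend hA))
    · rwa [zero_add, add_comm] at this
    · intro x
      funext w
      rcases w with w | w <;> simp [run, RGate.act, RGate.target, RGate.flips]
  | @xor A B T C f g hf hg _ ih =>
    intro W init hA
    obtain ⟨v, hv⟩ := hA f hf
    obtain ⟨w, hw⟩ := hA g hg
    have := exists_program_of_extend (T₀ := 0) (C₀ := 2)
      [RGate.cnot (Sum.inl v) (Sum.inr ()) (by simp), RGate.cnot (Sum.inl w) (Sum.inr ()) (by simp)]
      le_rfl le_rfl ?_ (ih _ (extend hA))
    · rwa [zero_add, add_comm] at this
    · intro x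
      funext w
      rcases w with w | w <;> simp [run, RGate.act, RGate.target, RGate.flips, hv, hw]
  | @and A B T C f g hf hg _ ih =>
    intro W init hA
    obtain ⟨v, hv⟩ := hA f hf
    obtain ⟨w, hw⟩ := hA g hg
    by_cases hvw : v = w
    -- The two controls of a Toffoli gate must differ, but here `f = g` and `f ∧ g` is on wire `v`.
    · subst hvw
      obtain ⟨V, i, P, hT, hC, hP⟩ := ih init (by
        rintro k (rfl | hk)
        · exact ⟨v, fun x => by simp [← hv, ← hw]⟩
        · exact hA k hk)
      exact ⟨V, i, P, by omega, hC, hP⟩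
    · have := exists_program_of_extend (T₀ := 1) (C₀ := 0)
        [RGate.toffoli (Sum.inl v) (Sum.inl w) (Sum.inr ()) (by simpa using hvw) (by simp)
          (by simp)] le_rfl le_rfl ?_ (ih _ (extend hA))
      · rwa [zero_add, add_comm] at this
      · intro x
        funext w
        rcases w with w | w <;> simp [run, RGate.act, RGate.target, RGate.flips, hv, hw]

/-- Bennett's method: compute, copy the outputs, and uncompute. A further ancilla triple allows
Toffoli gates without effect, so that any larger number of Toffoli gates can be reached. -/
theorem exists_reversible {Q P : Type} [Fintype P] {F : P → (Q → Bool) → Bool} {T C T' : ℕ}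
    (h : Comp (Set.range fun (q : Q) (x : Q → Bool) => x q) (Set.range F) T C)
    (hT' : 2 * T ≤ T') :
    ∃ (a : ℕ) (R : List (RGate ((Q ⊕ P) ⊕ Fin a))),
      R.countP RGate.isToffoli = T' ∧
      (R.countP fun g => !g.isToffoli) ≤ 2 * C + Fintype.card P ∧
      ∀ (x : Q → Bool) (y : P → Bool),
        run R (Sum.elim (Sum.elim x y) fun _ => false) =
          Sum.elim (Sum.elim x fun p => Bool.xor (y p) (F p x)) fun _ => false := by
  classical
  obtain ⟨V, _, R₀, hT, hC, hR⟩ := h.exists_program (W := Q) (fun x => x) (by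
    rintro _ ⟨q, rfl⟩; exact ⟨q, fun _ => rfl⟩)
  choose w hw using fun p => hR (F p) ⟨p, rfl⟩
  let ε : V ⊕ Fin 3 ≃ Fin (Fintype.card (V ⊕ Fin 3)) := Fintype.equivFin _
  let φ : Q ⊕ V ↪ (Q ⊕ P) ⊕ Fin (Fintype.card (V ⊕ Fin 3)) :=
    ⟨Sum.elim (fun q => Sum.inl (Sum.inl q)) fun v => Sum.inr (ε (Sum.inl v)), by
      rintro (q | v) (q' | v') h <;> simp at h ⊢ <;> exact h⟩
  have notMem_out (p : P) : Sum.inl (Sum.inr p) ∉ Set.range φ := by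
    rintro ⟨(q | v), h⟩
    · exact Sum.inl_ne_inr (Sum.inl_injective h)
    · exact Sum.inr_ne_inl h
  have notMem_pad (i : Fin 3) : Sum.inr (ε (Sum.inr i)) ∉ Set.range φ := by
    rintro ⟨(q | v), h⟩
    · exact Sum.inl_ne_inr h
    · exact Sum.inl_ne_inr (ε.injective (Sum.inr_injective h))
  let R₁ := R₀.map (RGate.map φ)
  let copy (p : P) : RGate ((Q ⊕ P) ⊕ Fin (Fintype.card (V ⊕ Fin 3))) :=
    RGate.cnot (φ (w p)) (Sum.inl (Sum.inr p)) fun h => notMem_out p ⟨_, h⟩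
  let copies := (Finset.univ : Finset P).toList.map copy
  -- Its controls are never set.
  let idle : RGate ((Q ⊕ P) ⊕ Fin (Fintype.card (V ⊕ Fin 3))) :=
    RGate.toffoli (Sum.inr (ε (Sum.inr 0))) (Sum.inr (ε (Sum.inr 1))) (Sum.inr (ε (Sum.inr 2)))
      (by simp) (by simp) (by simp)
  have count (p : Bool → Bool) :
      R₁.countP (fun g => p g.isToffoli) = R₀.countP fun g => p g.isToffoli := by
    rw [List.countP_map]; congr 1; funext g; simp
  have run_copies (l : List P) (hl : l.Nodup) (s : (Q ⊕ P) ⊕ Fin _ → Bool) :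
      (∀ p, run (l.map copy) s (Sum.inl (Sum.inr p)) =
        if p ∈ l then Bool.xor (s (Sum.inl (Sum.inr p))) (s (φ (w p)))
        else s (Sum.inl (Sum.inr p))) ∧
      ∀ v, (∀ p, v ≠ Sum.inl (Sum.inr p)) → run (l.map copy) s v = s v := by
    induction l generalizing s with
    | nil => simp [run]
    | cons p l ih =>
      obtain ⟨hp, hl⟩ := List.nodup_cons.1 hl
      obtain ⟨ih₁, ih₂⟩ := ih hl ((copy p).act s)
      have off (v) (hv : v ≠ Sum.inl (Sum.inr p)) : (copy p).act s v = s v := by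
        simp [copy, RGate.act, RGate.target, hv]
      refine ⟨fun p' => ?_, fun v hv => ?_⟩
      · rw [List.map_cons, run, ih₁, off (φ (w p')) fun h => notMem_out p ⟨_, h⟩]
        by_cases hpp : p' = p
        · subst hpp
          simp [hp, copy, RGate.act, RGate.target, RGate.flips]
        · rw [off _ (by simpa using hpp)]
          simp [hpp]
      · rw [List.map_cons, run, ih₂ v hv, off v (hv p)]
  have run_idle (c : ℕ) (s : (Q ⊕ P) ⊕ Fin _ → Bool) (hs : s (Sum.inr (ε (Sum.inr 0))) = false) :
      run (List.replicate c idle) s = s := by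
    induction c with
    | zero => rfl
    | succ c ih =>
      have : idle.act s = s := by
        simp [idle, RGate.act, RGate.target, RGate.flips, hs]
      rw [List.replicate_succ, run, this, ih]
  refine ⟨_, R₁ ++ copies ++ R₁.reverse ++
    List.replicate (T' - 2 * R₀.countP RGate.isToffoli) idle, ?_, ?_, fun x y => ?_⟩
  · have h1 : R₁.countP RGate.isToffoli = R₀.countP RGate.isToffoli := count id
    have h2 : copies.countP RGate.isToffoli = 0 := by
      rw [List.countP_map]; exact List.countP_eq_zero.2 (by simp [copy, RGate.isToffoli])
    have h3 : idle.isToffoli = true := rfl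
    simp only [List.countP_append, List.countP_reverse, h1, h2, List.countP_replicate, h3, if_true]
    omega
  · have h1 := count not
    have h2 : copies.countP (fun g => !g.isToffoli) ≤ Fintype.card P :=
      List.countP_le_length.trans (by simp [copies])
    have h3 : idle.isToffoli = true := rfl
    simp only [List.countP_append, List.countP_reverse, List.countP_replicate, h3, Bool.not_true,
      Bool.false_eq_true, if_false]
    omega
  · set s : (Q ⊕ P) ⊕ Fin _ → Bool := Sum.elim (Sum.elim x y) fun _ => false with hs
    have hsφ : s ∘ φ = Sum.elim x fun _ => false := by
      funext v; rcases v with v | v <;> rfl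
    obtain ⟨hc₁, hc₂⟩ := run_copies Finset.univ.toList (Finset.nodup_toList _) (run R₁ s)
    have hval (p : P) : run R₁ s (φ (w p)) = F p x := by
      rw [← hw p x, ← hsφ]
      exact congrFun (run_map_comp φ R₀ s) (w p)
    have hmid : run copies (run R₁ s) ∘ φ = run R₀ (s ∘ φ) := by
      rw [← run_map_comp φ R₀ s]
      funext v
      exact hc₂ _ fun p h => notMem_out p ⟨_, h⟩
    have hrev : R₁.reverse = R₀.reverse.map (RGate.map φ) := List.map_reverse.symm
    have key : run (R₁ ++ copies ++ R₁.reverse) s =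
        Sum.elim (Sum.elim x fun p => Bool.xor (y p) (F p x)) fun _ => false := by
      rw [run_append, run_append, hrev]
      have hin (v : Q ⊕ V) : run (R₀.reverse.map (RGate.map φ)) (run copies (run R₁ s)) (φ v) =
          s (φ v) := by
        refine (congrFun (run_map_comp φ _ _) v).trans ?_
        rw [hmid, run_reverse_run]
        rfl
      funext v
      rcases v with (q | p) | i
      · exact hin (Sum.inl q)
      · rw [run_map_of_notMem φ _ _ (notMem_out p)]
        refine (hc₁ p).trans ?_
        rw [if_pos (by simp), hval, run_map_of_notMem φ _ _ (notMem_out p)]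
        rfl
      · obtain ⟨(v | i), rfl⟩ := ε.surjective i
        · exact hin (Sum.inr v)
        · rw [run_map_of_notMem φ _ _ (notMem_pad i)]
          refine (hc₂ _ (by simp)).trans ?_
          rw [run_map_of_notMem φ _ _ (notMem_pad i)]
          rfl
    rw [run_append, key]
    exact run_idle _ _ rfl

/-! ### Quantum circuits of classical reversible gates -/

open Classical in
/-- The operator that maps the basis state `x` to the basis state `g x`. -/
noncomputable def permOp {Q : Type} (g : (Q → Bool) → Q → Bool) : Op Q :=
  Matrix.of fun y x => if y = g x then 1 else 0

section permOp

variable {Q : Type}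

theorem permOp_id [Fintype Q] [DecidableEq Q] : permOp (fun x : Q → Bool => x) = 1 := by
  ext y x
  simp [permOp, Matrix.one_apply]

theorem permOp_mul [Fintype Q] [DecidableEq Q] (g h : (Q → Bool) → Q → Bool) :
    permOp g * permOp h = permOp fun x => g (h x) := by
  ext y x
  simp [permOp, Matrix.mul_apply]

theorem permOp_conjTranspose {g : (Q → Bool) → Q → Bool} (hg : ∀ x, g (g x) = x) :
    (permOp g).conjTranspose = permOp g := by
  ext y x
  have : x = g y ↔ y = g x := ⟨fun h => by rw [h, hg], fun h => by rw [h, hg]⟩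
  simp [permOp, Matrix.conjTranspose_apply, this, apply_ite]

theorem permOp_conj_apply [Fintype Q] [DecidableEq Q] {g : (Q → Bool) → Q → Bool}
    (hg : ∀ x, g (g x) = x) (P : Op Q) (x y : Q → Bool) :
    (permOp g * P * (permOp g).conjTranspose) x y = P (g x) (g y) := by
  have h (x z : Q → Bool) : x = g z ↔ z = g x :=
    ⟨fun h => by rw [h, hg], fun h => by rw [h, hg]⟩
  rw [permOp_conjTranspose hg]
  simp only [permOp, Matrix.mul_apply, Matrix.of_apply, h x, ite_mul, one_mul, zero_mul,
    Finset.sum_ite_eq', Finset.mem_univ, if_true, mul_ite, mul_one, mul_zero]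

/-- A classical involution is a Clifford operator as soon as it maps Pauli strings to Pauli strings
up to phase. -/
theorem isClifford_permOp [Fintype Q] [DecidableEq Q] {g : (Q → Bool) → Q → Bool}
    (hg : ∀ x, g (g x) = x)
    (h : ∀ s : Q → Fin 4, ∃ (k : ℕ) (s' : Q → Fin 4), ∀ x y,
      pauliString s (g x) (g y) = Complex.I ^ k * pauliString s' x y) :
    IsClifford (permOp g) := by
  refine ⟨?_, ?_⟩
  · rw [Matrix.mem_unitaryGroup_iff, Matrix.star_eq_conjTranspose, permOp_conjTranspose hg,
      permOp_mul]
    simp only [hg]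
    exact permOp_id
  · rintro _ ⟨k, s, rfl⟩
    obtain ⟨k', s', hs⟩ := h s
    refine ⟨k + k', s', ?_⟩
    ext x y
    rw [permOp_conj_apply hg]
    simp only [Matrix.smul_apply, hs, smul_eq_mul, pow_add, mul_assoc]

theorem isClifford_not : IsClifford (permOp (RGate.not (0 : Fin 1)).act) := by
  refine isClifford_permOp (RGate.act_act _) fun s => ⟨![0, 0, 2, 2] (s 0), s, fun x y => ?_⟩
  simp only [pauliString, Matrix.of_apply, Finset.univ_unique, Finset.prod_singleton,
    RGate.act, RGate.target, RGate.flips, Fin.default_eq_zero, Function.update_self]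
  generalize s 0 = a
  generalize x 0 = b
  generalize y 0 = c
  fin_cases a <;> cases b <;> cases c <;> simp [pauliMatrix]

/-- A CNOT gate maps `X_c` to `X_c X_t` and `Z_t` to `Z_c Z_t` and fixes `Z_c` and `X_t`. A sign
occurs only for `X_c Z_t` and `Y_c Y_t`, which are exchanged. -/
theorem isClifford_cnot : IsClifford (permOp (RGate.cnot (0 : Fin 2) 1 (by decide)).act) := by
  refine isClifford_permOp (RGate.act_act _) fun s =>
    ⟨![![0, 0, 0, 0], ![0, 0, 0, 2], ![0, 0, 2, 0], ![0, 0, 0, 0]] (s 0) (s 1),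
      ![![![0, 0, 3, 3], ![1, 1, 2, 2], ![2, 2, 1, 1], ![3, 3, 0, 0]] (s 0) (s 1),
        ![![0, 1, 2, 3], ![1, 0, 3, 2], ![1, 0, 3, 2], ![0, 1, 2, 3]] (s 0) (s 1)], fun x y => ?_⟩
  have h (z : Fin 2 → Bool) : (RGate.cnot (0 : Fin 2) 1 (by decide)).act z 0 = z 0 := by
    simp [RGate.act, RGate.target]
  have h' (z : Fin 2 → Bool) : (RGate.cnot (0 : Fin 2) 1 (by decide)).act z 1 =
      Bool.xor (z 1) (z 0) := by
    simp [RGate.act, RGate.target, RGate.flips]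
  simp only [pauliString, Matrix.of_apply, Fin.prod_univ_two, h, h', Matrix.cons_val_zero,
    Matrix.cons_val_one]
  generalize s 0 = p
  generalize s 1 = q
  generalize x 0 = a
  generalize x 1 = b
  generalize y 0 = c
  generalize y 1 = d
  fin_cases p <;> fin_cases q <;> cases a <;> cases b <;> cases c <;> cases d <;>
    simp [pauliMatrix]

theorem toffoliMatrix_eq : toffoliMatrix =
    permOp (RGate.toffoli (0 : Fin 3) 1 2 (by decide) (by decide) (by decide)).act := by
  ext y x
  simp only [toffoliMatrix, permOp, Matrix.of_apply]
  congr 1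
  simp [funext_iff, Fin.forall_fin_succ, RGate.act, RGate.target, RGate.flips,
    Function.update_apply]

theorem embedOp_permOp {k : ℕ} (e : Fin k ↪ Q) (g : RGate (Fin k)) :
    embedOp e (permOp g.act) = permOp (g.map e).act := by
  ext y x
  simp only [embedOp, permOp, Matrix.of_apply, ← ite_and]
  congr 1
  refine propext ⟨fun ⟨h, h'⟩ => ?_, ?_⟩
  · funext q
    by_cases hq : q ∈ Set.range e
    · obtain ⟨i, rfl⟩ := hq
      rw [RGate.act_map_apply]
      exact congrFun h' i
    · rw [RGate.act_map_of_notMem _ _ _ hq, h q hq]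
  · rintro rfl
    exact ⟨fun q hq => RGate.act_map_of_notMem _ _ _ hq,
      funext fun i => RGate.act_map_apply _ _ _ _⟩

/-- The quantum gate that performs a classical reversible gate. -/
noncomputable def RGate.toGate : RGate Q → Gate Q
  | .not t => .cliffordOne _ isClifford_not ⟨fun _ => t, fun _ _ _ => Subsingleton.elim _ _⟩
  | .cnot c t h => .cliffordTwo _ isClifford_cnot ⟨![c, t], by
      intro i j; fin_cases i <;> fin_cases j <;> simp [h, h.symm]⟩
  | .toffoli a b t hab hat hbt => .toffoli ⟨![a, b, t], by
      intro i j
      fin_cases i <;> fin_cases j <;> simp [hab, hat, hbt, hab.symm, hat.symm, hbt.symm]⟩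

@[simp] theorem RGate.isToffoli_toGate (g : RGate Q) : g.toGate.isToffoli = g.isToffoli := by
  cases g <;> rfl

theorem RGate.op_toGate (g : RGate Q) : g.toGate.op = permOp g.act := by
  cases g with
  | not t => exact embedOp_permOp _ _
  | cnot c t h => exact embedOp_permOp _ _
  | toffoli a b t hab hat hbt =>
    refine (congrArg (embedOp _) toffoliMatrix_eq).trans ?_
    exact embedOp_permOp _ _

theorem op_map_toGate [Fintype Q] [DecidableEq Q] (P : List (RGate Q)) :
    Circuit.op (P.map RGate.toGate) = permOp (run P) := by
  induction P with
  | nil => exact permOp_id.symm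
  | cons g P ih =>
    rw [List.map_cons, Circuit.op, ih, RGate.op_toGate, permOp_mul]
    rfl

theorem implements_permOp [Fintype Q] [DecidableEq Q] {a : ℕ} (P : List (RGate (Q ⊕ Fin a)))
    {g : (Q → Bool) → Q → Bool}
    (h : ∀ x, run P (Sum.elim x fun _ => false) = Sum.elim (g x) fun _ => false) :
    Circuit.Implements (P.map RGate.toGate) (permOp g) := by
  intro ψ
  rw [op_map_toGate]
  funext y
  let ι (x : Q → Bool) : Q ⊕ Fin a → Bool := Sum.elim x fun _ => false
  have hι : Function.Injective ι := fun x x' hx => by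
    funext q; exact congrFun hx (Sum.inl q)
  have hsum : Matrix.mulVec (permOp (run P)) (withAncillas a ψ) y =
      ∑ x, permOp (run P) y (ι x) * ψ x := by
    refine (Finset.sum_of_injOn ι hι.injOn (by simp) ?_ ?_).symm
    · intro z _ hz
      have : ¬ ∀ i, z (Sum.inr i) = false := by
        intro hz'
        refine hz ⟨z ∘ Sum.inl, by simp, ?_⟩
        funext v
        rcases v with v | v
        · rfl
        · exact (hz' v).symm
      simp [withAncillas, this]
    · intro x _
      simp only [withAncillas, ι, Sum.elim_inr, implies_true, if_true]
      rfl
  rw [hsum]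
  simp only [permOp, Matrix.of_apply, ι, h, withAncillas, Matrix.mulVec, dotProduct]
  split_ifs with hy
  · refine Finset.sum_congr rfl fun x _ => ?_
    congr 2
    refine propext ⟨fun hx => by rw [hx]; rfl, fun hx => ?_⟩
    funext v
    rcases v with v | v
    · exact congrFun hx v
    · exact hy v
  · refine Finset.sum_eq_zero fun x _ => ?_
    rw [if_neg, zero_mul]
    rintro rfl
    exact hy fun _ => rfl

end permOp

theorem tensorPow_oracle {n m : ℕ} (r : ℕ) (f : (Fin n → Bool) → Fin m → Bool) :
    tensorPow r (oracle f) = permOp fun x i => Sum.elim (fun q => x (i.1, Sum.inl q))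
      (fun j => Bool.xor (x (i.1, Sum.inr j)) (f (fun q => x (i.1, Sum.inl q)) j)) i.2 := by
  classical
  ext y x
  simp only [tensorPow, oracle, permOp, Matrix.of_apply]
  rw [Finset.prod_ite_zero]
  simp only [Finset.prod_const_one, Finset.mem_univ, forall_true_left]
  congr 1
  refine propext ⟨fun h => ?_, ?_⟩
  · funext ⟨p, i⟩
    rcases i with q | j
    · exact congrFun (h p).1 q
    · exact (h p).2 j
  · rintro rfl p
    exact ⟨rfl, fun j => rfl⟩

/-- Mass production of Boolean functions yields circuits for the tensor powers of the oracles, with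
any prescribed number of Toffoli gates that is at least twice the number of AND gates. -/
theorem MassProduction.exists_circuit {m n t T C T' : ℕ} (h : MassProduction m n t T C)
    (hT' : 2 * T ≤ T') (f : (Fin n → Bool) → Fin m → Bool) :
    ∃ (a : ℕ) (R : Circuit ((Fin (2 ^ t) × (Fin n ⊕ Fin m)) ⊕ Fin a)),
      R.Implements (tensorPow (2 ^ t) (oracle f)) ∧
      R.cliffordCount ≤ 2 * C + 2 ^ t * m ∧ R.toffoliCount = T' := by
  have hcomp := h f (Fintype.card_fin (2 ^ t))
    (A := Set.range fun (q : Fin (2 ^ t) × Fin n) (x : Fin (2 ^ t) × Fin n → Bool) => x q)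
    (fun p q x => x (p, q)) fun p q => ⟨(p, q), rfl⟩
  obtain ⟨a, P, hP, hC, hrun⟩ := exists_reversible (P := Fin (2 ^ t) × Fin m)
    (F := fun i x => f (fun q => x (i.1, q)) i.2)
    (hcomp.mono_target (by rintro _ ⟨⟨p, j⟩, rfl⟩; exact ⟨p, j, rfl⟩)) hT'
  let α := Equiv.prodSumDistrib (Fin (2 ^ t)) (Fin n) (Fin m)
  let φ := (Equiv.sumCongr α.symm (Equiv.refl (Fin a))).toEmbedding
  refine ⟨a, (P.map (RGate.map φ)).map RGate.toGate, ?_, ?_, ?_⟩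
  · rw [tensorPow_oracle]
    refine implements_permOp _ fun x => ?_
    have hx : (Sum.elim x fun _ => false : _ ⊕ Fin a → Bool) ∘ φ =
        Sum.elim (Sum.elim (fun i => x (i.1, Sum.inl i.2)) fun i => x (i.1, Sum.inr i.2))
          fun _ => false := by
      funext v
      rcases v with (v | v) | v <;> rfl
    have key := run_map_comp φ P (Sum.elim x fun _ => false)
    rw [hx, hrun] at key
    funext v
    obtain ⟨v, rfl⟩ : ∃ w, φ w = v := (Equiv.sumCongr α.symm (Equiv.refl (Fin a))).surjective v
    refine (congrFun key v).trans ?_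
    rcases v with (v | v) | v <;> rfl
  · have h1 : ((P.map (RGate.map φ)).map RGate.toGate).countP (fun g => !g.isToffoli) =
        P.countP fun g => !g.isToffoli := by
      rw [List.countP_map, List.countP_map]; congr 1; funext g; simp
    refine (h1.trans_le hC).trans_eq ?_
    simp
  · have h1 : ((P.map (RGate.map φ)).map RGate.toGate).countP (fun g => g.isToffoli) =
        P.countP RGate.isToffoli := by
      rw [List.countP_map, List.countP_map]; congr 1; funext g; simp
    exact h1.trans hP

/-! ### Choice of parameters -/

/-- The overhead `(1 + 2 ^ (-k)) ^ t` of mass production is bounded for `t ≤ 2 ^ k`. -/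
theorem two_pow_add_one_pow_le {k t : ℕ} (h : t ≤ 2 ^ k) : (2 ^ k + 1) ^ t ≤ 3 * 2 ^ (t * k) := by
  have hk : (0 : ℝ) < 2 ^ k := by positivity
  have h1 : ((2 : ℝ) ^ k + 1) ^ t = 2 ^ (t * k) * (1 / 2 ^ k + 1) ^ t := by
    rw [mul_comm t k, pow_mul, ← mul_pow]
    congr 1
    field_simp
    ring
  have h2 : (1 / (2 : ℝ) ^ k + 1) ^ t ≤ 3 := by
    calc (1 / (2 : ℝ) ^ k + 1) ^ t ≤ Real.exp (1 / 2 ^ k) ^ t :=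
          pow_le_pow_left₀ (by positivity) (Real.add_one_le_exp _) t
      _ = Real.exp (t / 2 ^ k) := by rw [← Real.exp_nat_mul]; congr 1; ring
      _ ≤ Real.exp 1 := by
          refine Real.exp_le_exp.2 ((div_le_one hk).2 ?_)
          exact_mod_cast h
      _ ≤ 3 := by linarith [Real.exp_one_lt_d9]
  have h3 : ((2 : ℝ) ^ k + 1) ^ t ≤ 3 * 2 ^ (t * k) := by
    rw [h1, mul_comm (3 : ℝ)]
    exact mul_le_mul_of_nonneg_left h2 (by positivity)
  exact_mod_cast h3

theorem massProduction_of_add {m d l k : ℕ} (hm : 1 ≤ m) (t : ℕ) :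
    MassProduction m (t * k + (d + l)) t
      ((2 ^ k + 1) ^ t * (2 ^ d + m * 2 ^ l + t * (21 * 2 ^ k * (t * k + (d + l) + m + 1))))
      ((2 ^ k + 1) ^ t * (13 * (2 ^ (d + l) * m) +
        t * (21 * 2 ^ k * (t * k + (d + l) + m + 1)))) :=
  (massProduction_lookup hm d l).iterate t le_rfl

/-- Circuits for `2 ^ t` copies of the oracle, with gate counts that do not depend on `f`. -/
theorem exists_uniform_circuit {m : ℕ} (hm : 1 ≤ m) (n t : ℕ) :
    ∃ C T : ℕ, ∀ f : (Fin n → Bool) → Fin m → Bool,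
      ∃ (a : ℕ) (R : Circuit ((Fin (2 ^ t) × (Fin n ⊕ Fin m)) ⊕ Fin a)),
        R.Implements (tensorPow (2 ^ t) (oracle f)) ∧ R.cliffordCount ≤ C ∧
          R.toffoliCount = T := by
  have h := massProduction_of_add (d := n) (l := 0) (k := 0) hm t
  rw [mul_zero, zero_add, add_zero] at h
  exact ⟨_, _, fun f => h.exists_circuit le_rfl f⟩

/-- With `λ = 2 ^ j`, tables with `16 λ` columns leave room for all constant factors in the number
`2 ^ n / λ` of Toffoli gates. Here `M = n - 2 log₂ λ`, the factor `2 ^ e` absorbs `m`, and the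
hypothesis on `t k` bounds the number of mass production steps. -/
theorem exists_circuit_of_le {n m j t k e M : ℕ} (hm : 1 ≤ m) (hn : n = M + 2 * j)
    (hk : n < 2 ^ k) (ht : 100 * (t * k) ≤ M) (he : 504 * (m + 1) ≤ 2 ^ e) (heM : 100 * e ≤ M)
    (f : (Fin n → Bool) → Fin m → Bool) :
    ∃ (a : ℕ) (R : Circuit ((Fin (2 ^ t) × (Fin n ⊕ Fin m)) ⊕ Fin a)),
      R.Implements (tensorPow (2 ^ t) (oracle f)) ∧ R.cliffordCount ≤ 80 * (2 ^ n * m) ∧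
        R.toffoliCount = 2 ^ (n - j) := by
  have he0 : 9 ≤ e := by
    by_contra! h
    have := Nat.pow_le_pow_right (n := 2) (by norm_num) (Nat.le_of_lt_succ h)
    omega
  have hk0 : 1 ≤ k := by
    rcases Nat.eq_zero_or_pos k with rfl | h
    · rw [pow_zero] at hk; omega
    · exact h
  have htk : t ≤ t * k := Nat.le_mul_of_pos_right t hk0
  have htn : t ≤ 2 ^ k := by omega
  obtain ⟨d, hd⟩ : ∃ d, n = t * k + (d + (j + 4)) := ⟨n - (t * k + (j + 4)), by omega⟩
  have hmass := massProduction_of_add (d := d) (l := j + 4) (k := k) hm t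
  rw [← hd] at hmass
  set W := (2 ^ k + 1) ^ t with hW
  have hWle : W ≤ 3 * 2 ^ (t * k) := two_pow_add_one_pow_le htn
  have pow_le {a b : ℕ} (h : a ≤ b) : 2 ^ a ≤ 2 ^ b := Nat.pow_le_pow_right (by norm_num) h
  -- The shares of encoding, selection and routing in the budget `2 ^ (n - j)`, after doubling, are
  -- `3 / 8`, `1 / 4` and `1 / 4`.
  have hencode : W * 2 ^ d * 16 ≤ 3 * 2 ^ (n - j) := by
    have : 2 ^ (n - j) = 2 ^ (t * k) * 2 ^ d * 16 := by
      rw [show n - j = t * k + d + 4 by omega, pow_add, pow_add]; norm_num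
    rw [this]
    nlinarith [Nat.mul_le_mul_right (2 ^ d * 16) hWle]
  have hselect : 8 * (W * (m * 2 ^ (j + 4))) ≤ 2 ^ (n - j) := by
    calc 8 * (W * (m * 2 ^ (j + 4))) ≤ 8 * (3 * 2 ^ (t * k) * (m * 2 ^ (j + 4))) := by gcongr
      _ = 384 * m * 2 ^ (t * k + j) := by rw [pow_add, pow_add]; ring
      _ ≤ 2 ^ e * 2 ^ (t * k + j) := Nat.mul_le_mul_right _ (by omega)
      _ = 2 ^ (e + (t * k + j)) := by rw [← pow_add]
      _ ≤ 2 ^ (n - j) := pow_le (by omega)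
  have hroute : 8 * (W * (t * (21 * 2 ^ k * (n + m + 1)))) ≤ 2 ^ (n - j) := by
    -- Without mass production steps there is no routing; otherwise `k ≤ t k` bounds its cost.
    rcases Nat.eq_zero_or_pos t with rfl | ht0
    · simp
    have hkt : k ≤ t * k := Nat.le_mul_of_pos_left k ht0
    have hnm : n + m + 1 ≤ 2 ^ k * (m + 1) := by
      have := Nat.le_mul_of_pos_left m (Nat.two_pow_pos k)
      rw [Nat.mul_add, mul_one]
      omega
    calc 8 * (W * (t * (21 * 2 ^ k * (n + m + 1))))
        ≤ 8 * (3 * 2 ^ (t * k) * (2 ^ k * (21 * 2 ^ k * (2 ^ k * (m + 1))))) := by gcongr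
      _ = 504 * (m + 1) * 2 ^ (t * k + k + k + k) := by simp only [pow_add]; ring
      _ ≤ 2 ^ e * 2 ^ (t * k + k + k + k) := Nat.mul_le_mul_right _ he
      _ = 2 ^ (e + (t * k + k + k + k)) := by rw [← pow_add]
      _ ≤ 2 ^ (n - j) := pow_le (by omega)
  have hT : 2 * (W * (2 ^ d + m * 2 ^ (j + 4) + t * (21 * 2 ^ k * (n + m + 1)))) ≤
      2 ^ (n - j) := by
    rw [Nat.mul_add W, Nat.mul_add W]
    omega
  obtain ⟨a, R, hR, hC, hT'⟩ := hmass.exists_circuit hT f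
  refine ⟨a, R, hR, hC.trans ?_, hT'⟩
  have h1 : W * (13 * (2 ^ (d + (j + 4)) * m)) ≤ 39 * (2 ^ n * m) := by
    calc W * (13 * (2 ^ (d + (j + 4)) * m))
        ≤ 3 * 2 ^ (t * k) * (13 * (2 ^ (d + (j + 4)) * m)) := by gcongr
      _ = 39 * (2 ^ (t * k + (d + (j + 4))) * m) := by rw [pow_add 2 (t * k)]; ring
      _ = 39 * (2 ^ n * m) := by rw [← hd]
  have h2 : 2 ^ (n - j) ≤ 2 ^ n * m :=
    (pow_le (Nat.sub_le n j)).trans (Nat.le_mul_of_pos_right _ hm)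
  have h3 : 2 ^ t * m ≤ 2 ^ n * m := Nat.mul_le_mul_right m (pow_le (by omega))
  rw [Nat.mul_add]
  omega

open Filter Asymptotics in
/-- The growth conditions of the theorem, in the form used by `exists_circuit_of_le`. -/
theorem eventually_parameters (j t : ℕ → ℕ)
    (hj : (fun n : ℕ => (((2 ^ j n : ℕ) : ℝ))) =o[atTop]
      fun n : ℕ => (2 : ℝ) ^ ((n : ℝ) / 2) / Real.sqrt (n : ℝ))
    (ht : (fun n : ℕ => Real.logb 2 ((2 ^ t n : ℕ) : ℝ)) =o[atTop]
      fun n : ℕ => ((n : ℝ) - 2 * Real.logb 2 ((2 ^ j n : ℕ) : ℝ)) / Real.logb 2 (n : ℝ)) (E : ℕ) :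
    ∀ᶠ n in atTop, ∃ M, n = M + 2 * j n ∧ E ≤ M ∧ 100 * (t n * (Nat.log 2 n + 1)) ≤ M := by
  filter_upwards [hj.bound one_pos, ht.bound (show (0 : ℝ) < 1 / 200 by norm_num),
    eventually_ge_atTop 2, eventually_ge_atTop (2 ^ E)] with n h1 h2 hn2 hnE
  have hn0 : (0 : ℝ) < n := by positivity
  have hpow : 2 ^ (2 * j n) * n ≤ 2 ^ n := by
    rw [one_mul, Real.norm_of_nonneg (by positivity), Real.norm_of_nonneg (by positivity),
      le_div_iff₀ (Real.sqrt_pos.2 hn0)] at h1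
    have h3 := pow_le_pow_left₀ (by positivity) h1 2
    rw [mul_pow, Real.sq_sqrt hn0.le, ← Real.rpow_natCast ((2 : ℝ) ^ _), ← Real.rpow_mul two_pos.le,
      Nat.cast_ofNat, div_mul_cancel₀ _ (two_ne_zero' ℝ), Real.rpow_natCast] at h3
    rw [mul_comm 2, pow_mul]
    exact_mod_cast h3
  have hjn : 2 * j n ≤ n := by
    refine (Nat.pow_le_pow_iff_right (a := 2) (by norm_num)).1 (le_trans ?_ hpow)
    exact Nat.le_mul_of_pos_right _ (by omega)
  obtain ⟨M, hM⟩ := Nat.exists_eq_add_of_le' hjn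
  refine ⟨M, hM, ?_, ?_⟩
  · have : n ≤ 2 ^ M := by
      have h3 : 2 ^ n = 2 ^ (2 * j n) * 2 ^ M := by
        rw [← pow_add, add_comm (2 * j n) M, ← hM]
      rw [h3] at hpow
      exact Nat.le_of_mul_le_mul_left hpow (by positivity)
    exact (Nat.pow_le_pow_iff_right (a := 2) (by norm_num)).1 (hnE.trans this)
  · have hlog (a : ℕ) : Real.logb 2 ((2 ^ a : ℕ) : ℝ) = a := by
      rw [Nat.cast_pow, Nat.cast_ofNat, Real.logb_pow, Real.logb_self_eq_one one_lt_two, mul_one]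
    have hMn : (n : ℝ) - 2 * (j n : ℝ) = M := by
      rw [sub_eq_iff_eq_add]; exact_mod_cast hM
    have hL1 : (1 : ℝ) ≤ Real.logb 2 n := by
      rw [Real.le_logb_iff_rpow_le one_lt_two hn0, Real.rpow_one]
      exact_mod_cast hn2
    have hL2 : (Nat.log 2 n : ℝ) ≤ Real.logb 2 n := by
      have := Real.natLog_le_logb n 2
      exact_mod_cast this
    rw [hlog, hlog, hMn, Real.norm_of_nonneg (by positivity),
      Real.norm_of_nonneg (by positivity), ← mul_div_assoc, le_div_iff₀ (by linarith)] at h2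
    have ht0 : (0 : ℝ) ≤ t n := by positivity
    have h4 : (100 : ℝ) * (t n * (Nat.log 2 n + 1)) ≤ M := by nlinarith
    exact_mod_cast h4

end QROM

theorem mainTheorem1 :
    ∃ K : ℝ, ∀ (m : ℕ), 1 ≤ m →
      ∀ (lam r : ℕ → ℕ),
        (∀ n, ∃ j : ℕ, lam n = 2 ^ j) →
        (fun n : ℕ => (lam n : ℝ)) =o[Filter.atTop]
          (fun n : ℕ => (2 : ℝ) ^ ((n : ℝ) / 2) / Real.sqrt (n : ℝ)) →
        (∀ᶠ n : ℕ in Filter.atTop,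
          (lam n : ℝ) ≤ (2 : ℝ) ^ ((n : ℝ) / 2) * (m : ℝ) ^ (-(1 / 2) : ℝ)) →
        (∀ n, ∃ t : ℕ, r n = 2 ^ t) →
        (fun n : ℕ => Real.logb 2 (r n : ℝ)) =o[Filter.atTop]
          (fun n : ℕ => ((n : ℝ) - 2 * Real.logb 2 (lam n : ℝ)) / Real.logb 2 (n : ℝ)) →
        ∃ δ ε : ℕ → ℝ,
          Filter.Tendsto δ Filter.atTop (nhds 0) ∧ Filter.Tendsto ε Filter.atTop (nhds 0) ∧
          ∀ (n : ℕ) (f : (Fin n → Bool) → (Fin m → Bool)),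
            ∃ (a : ℕ) (C : QROM.Circuit ((Fin (r n) × (Fin n ⊕ Fin m)) ⊕ Fin a)),
              QROM.Circuit.Implements C (QROM.tensorPow (r n) (QROM.oracle f)) ∧
              (QROM.Circuit.cliffordCount C : ℝ) ≤ (K + δ n) * ((2 : ℝ) ^ n * (m : ℝ)) ∧
              |(QROM.Circuit.toffoliCount C : ℝ) - (2 : ℝ) ^ n / (lam n : ℝ)| ≤
                ε n * ((2 : ℝ) ^ n / (lam n : ℝ)) := by
  classical
  refine ⟨80, fun m hm lam r hlam hlamo _ hr hro => ?_⟩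
  choose j hj using hlam
  choose t ht using hr
  obtain rfl : lam = fun n => 2 ^ j n := funext hj
  obtain rfl : r = fun n => 2 ^ t n := funext ht
  let good (n : ℕ) : Prop := ∀ f : (Fin n → Bool) → Fin m → Bool,
    ∃ (a : ℕ) (R : QROM.Circuit ((Fin (2 ^ t n) × (Fin n ⊕ Fin m)) ⊕ Fin a)),
      R.Implements (QROM.tensorPow (2 ^ t n) (QROM.oracle f)) ∧
        R.cliffordCount ≤ 80 * (2 ^ n * m) ∧ (R.toffoliCount : ℝ) = 2 ^ n / (2 ^ j n : ℕ)
  have hgood : ∀ᶠ n in Filter.atTop, good n := by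
    filter_upwards [QROM.eventually_parameters j t hlamo hro (100 * (504 * (m + 1)))]
      with n ⟨M, hM, hE, htM⟩ f
    obtain ⟨a, R, hR, hC, hT⟩ := QROM.exists_circuit_of_le hm hM (Nat.lt_pow_succ_log_self
      one_lt_two n) htM (Nat.lt_two_pow_self (n := 504 * (m + 1))).le hE f
    refine ⟨a, R, hR, hC, ?_⟩
    rw [hT, eq_div_iff (by positivity)]
    exact_mod_cast (by rw [← pow_add, Nat.sub_add_cancel (by omega)] :
      2 ^ (n - j n) * 2 ^ j n = 2 ^ n)
  -- For the finitely many other `n`, any circuits with counts independent of `f` will do.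
  choose C₀ T₀ hCT using fun n => QROM.exists_uniform_circuit hm n (t n)
  refine ⟨fun n => if good n then 0 else C₀ n,
    fun n => if good n then 0 else
      |(T₀ n : ℝ) - 2 ^ n / (2 ^ j n : ℕ)| / (2 ^ n / (2 ^ j n : ℕ)), ?_, ?_, fun n f => ?_⟩
  · exact tendsto_const_nhds.congr' (hgood.mono fun n hn => (if_pos hn).symm)
  · exact tendsto_const_nhds.congr' (hgood.mono fun n hn => (if_pos hn).symm)
  · dsimp only
    by_cases hn : good n
    · obtain ⟨a, R, hR, hC, hT⟩ := hn f
      refine ⟨a, R, hR, ?_, ?_⟩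
      · rw [if_pos hn, add_zero]
        exact_mod_cast hC
      · rw [if_pos hn, hT, sub_self, abs_zero, zero_mul]
    · obtain ⟨a, R, hR, hC, hT⟩ := hCT n f
      refine ⟨a, R, hR, ?_, ?_⟩
      · rw [if_neg hn]
        have h1 : (R.cliffordCount : ℝ) ≤ C₀ n := by exact_mod_cast hC
        have h2 : (1 : ℝ) ≤ 2 ^ n * m :=
          one_le_mul_of_one_le_of_one_le (one_le_pow₀ one_le_two) (by exact_mod_cast hm)
        have h3 : (0 : ℝ) ≤ C₀ n := by positivity
        nlinarith
      · rw [if_neg hn, hT, div_mul_cancel₀ _ (by positivity)]
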